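/- Let $V$ be a set of values (values, invocations, return values and names of objects are coded by natural numbers, so that Turing machines can handle them) and let the fetch-and-cons type over $V$ have as states the finite lists over $V$, as initial state the empty list, and the single operation $\mathrm{fac}(v)$, $v\in V$, which adds $v$ at the head of the list and returns the whole list stored before. Let $n$ be a number of processes and let $\mathcal O$ be a set of linearizable shared objects, each given by its data type (states, initial states, invocations, return values, and a transition relation that is defined for every invocation in every state). An $n$-process implementation of fetch-and-cons from $\mathcal O$ consists of a program for each process (a Turing machine that computes locally, accesses the objects of $\mathcal O$ and finally returns a value; its local memory persists from one operation to the next), an initial content of the local memories, and for each object of $\mathcal O$ a state to which it is initialized, which may be any state reachable from its initial states. Its histories are the finite or infinite sequences of invocation and response events of fetch-and-cons operations that arise in its executions, where every process performs arbitrary $\mathrm{fac}$ operations one after the other and the steps of different processes interleave arbitrarily. The implementation is wait-free if in every execution each invoked operation terminates after finitely many steps of its process, regardless of the other processes. A sequential history is legal if its operations and responses form a run of the fetch-and-cons type from the empty list. A history $H$ is weakly consistent if for every operation $o$ of a process $p$ that has a response in $H$ there is a legal sequential history that contains only operations invoked in $H$ before $o$ returns, contains all operations of $p$ that precede $o$,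 and ends with $o$ and its response in $H$. For $t\ge 0$ let $H_t$ be $H$ without its first $t$ events. A $t$-linearization of $H$ is a legal sequential history $S$ such that (1) every operation in $S$ is invoked in $H$; (2) every operation completed in $H$ is completed in $S$; (3) if the response of $o_1$ precedes the invocation of $o_2$, both these events are in $H_t$ and $o_2$ is in $S$, then $o_1$ precedes $o_2$ in $S$; (4) every operation with a response in $H_t$ has the same response in $S$. An implementation is eventually linearizable if each of its histories is weakly consistent and has a $t$-linearization for some $t$ (which may depend on the history); it is linearizable if each of its histories has a $0$-linearization. Claim: if there is an $n$-process eventually linearizable wait-free implementation of fetch-and-cons from $\mathcal O$, then there is an $n$-process linearizable wait-free implementation of fetch-and-cons from $\mathcal O$. -/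

import Mathlib

universe u v

/-- An abstract data type: a labelled transition system with a set of states, a set of possible
initial states, invocations, return values and a transition relation. Every invocation is defined
in every state (for a deterministic type `Trans` is the graph of a map). Invocations and return
values are read and written by Turing machines, so they are coded by natural numbers; the states
are arbitrary. -/
structure DataType where
  State : Type u
  Init : Set State
  Inv : Type
  Res : Type
  [invCode : Primcodable Inv]
  [resCode : Primcodable Res]
  /-- `Trans s x r s'`: in state `s` the invocation `x` may return `r` and lead to `s'`. -/
  Trans : State → Inv → Res → State → Prop
  total : ∀ s x, ∃ r s', Trans s x r s'

attribute [instance] DataType.invCode DataType.resCode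

/-- A state that is reachable from an initial state of the type. -/
def DataType.Reachable (T : DataType.{u}) (s : T.State) : Prop :=
  ∃ s₀ ∈ T.Init, Relation.ReflTransGen (fun a b => ∃ x r, T.Trans a x r b) s₀ s

/-- The fetch-and-cons type over the value set `V`: the state is a list, initially empty; `fac v`
adds `v` at the head of the list and returns the whole list stored before. -/
abbrev fetchAndCons (V : Type) [Primcodable V] : DataType.{0} where
  State := List V
  Init := {[]}
  Inv := V
  Res := List V
  Trans := fun L v r L' => r = L ∧ L' = v :: L
  total := fun L v => ⟨L, v :: L, rfl, rfl⟩

/-! ### Histories -/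

/-- Invocation and response events, by `n` processes, at an object of type `T`. -/
inductive Event (n : ℕ) (T : DataType.{u}) where
  | inv (p : Fin n) (x : T.Inv)
  | res (p : Fin n) (r : T.Res)

/-- The process that performs the event. -/
def Event.proc {n : ℕ} {T : DataType.{u}} : Event n T → Fin n
  | .inv p _ => p
  | .res p _ => p

/-- A finite or infinite history, as a sequence of events with time stamps: `H k = some e` means
that `e` happens at time `k`, and `H k = none` that no event happens at time `k`. An operation of
`H` is identified with the time of its invocation event. -/
abbrev History (n : ℕ) (T : DataType.{u}) := ℕ → Option (Event n T)

namespace History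

variable {n : ℕ} {T : DataType.{u}}

/-- The operation invoked at time `k` by process `p` completes at time `k'`, returning `r`: the
next event of `p` after its invocation is this response. -/
def Completes (H : History n T) (k k' : ℕ) (p : Fin n) (r : T.Res) : Prop :=
  (∃ x, H k = some (.inv p x)) ∧ k < k' ∧ H k' = some (.res p r) ∧
    ∀ j, k < j → j < k' → ∀ e, H j = some e → e.proc ≠ p

/-- The time `k` belongs to the suffix of `H` obtained by removing its first `t` events: at least
`t` events happen before `k`. -/
def InSuffix (H : History n T) (t k : ℕ) : Prop :=
  t ≤ Nat.count (fun j => (H j).isSome = true) k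

/-- `S` is a legal sequential history made of operations of `H`: `S j = some (k, r)` means that
slot `j` of `S` holds the operation of `H` invoked at time `k`, with response `r` (slots may be
left empty). No operation occurs twice, and the invocations with these responses are a run of `T`
from an initial state. -/
def Legal (H : History n T) (S : ℕ → Option (ℕ × T.Res)) : Prop :=
  (∀ i j k r r', S i = some (k, r) → S j = some (k, r') → i = j) ∧
  ∃ σ : ℕ → T.State, σ 0 ∈ T.Init ∧
    (∀ j, S j = none → σ (j + 1) = σ j) ∧
    ∀ j k r, S j = some (k, r) →
      ∃ p x, H k = some (.inv p x) ∧ T.Trans (σ j) x r (σ (j + 1))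

/-- `S` is a `t`-linearization of `H`. -/
structure IsLinearization (H : History n T) (t : ℕ) (S : ℕ → Option (ℕ × T.Res)) : Prop where
  /-- `S` is a legal sequential history, all operations of which are invoked in `H`. -/
  legal : H.Legal S
  /-- Every operation completed in `H` is completed in `S`. -/
  complete : ∀ k k' p r, H.Completes k k' p r → ∃ j r', S j = some (k, r')
  /-- If the response of `k₁` precedes the invocation of `k₂`, both events being in the suffix,
  and `k₂` is in `S`, then `k₁` precedes `k₂` in `S`. -/
  order : ∀ k₁ k₁' p₁ r₁ k₂ j₂ r₂, H.Completes k₁ k₁' p₁ r₁ → k₁' < k₂ →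
    H.InSuffix t k₁' → H.InSuffix t k₂ → S j₂ = some (k₂, r₂) →
    ∃ j₁ r, j₁ < j₂ ∧ S j₁ = some (k₁, r)
  /-- An operation with a response in the suffix has the same response in `S`. -/
  same : ∀ k k' p r, H.Completes k k' p r → H.InSuffix t k' → ∃ j, S j = some (k, r)

/-- `H` is `t`-linearizable. -/
def TLinearizable (H : History n T) (t : ℕ) : Prop :=
  ∃ S, H.IsLinearization t S

/-- Linearizability is `t`-linearizability where no event is removed. -/
def Linearizable (H : History n T) : Prop :=
  H.TLinearizable 0

/-- Weak consistency: each completed operation `k` has an explanation, that is a legal finite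
sequential history of operations invoked before `k` returns, which contains all operations of the
same process that precede `k`, and ends with `k` and its response. -/
def WeaklyConsistent (H : History n T) : Prop :=
  ∀ k k' p r, H.Completes k k' p r →
    ∃ l : List (ℕ × T.Res),
      H.Legal (fun j => (l ++ [(k, r)])[j]?) ∧
      (∀ a ∈ l, a.1 < k') ∧
      ∀ k₁ k₁' r₁, H.Completes k₁ k₁' p r₁ → k₁' < k → ∃ r', (k₁, r') ∈ l

/-- `H` is eventually linearizable. -/
def EventuallyLinearizable (H : History n T) : Prop :=
  H.WeaklyConsistent ∧ ∃ t, H.TLinearizable t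

end History

/-! ### Implementations -/

/-- What a process does next in the course of an operation of the implemented object `T`. -/
inductive ProgramAction {ι : Type} (O : ι → DataType.{u}) (T : DataType.{v}) where
  /-- a step of local computation, which changes the local memory to `m` -/
  | compute (m : ℕ)
  /-- apply the invocation `x` to the shared object `O i` -/
  | access (i : ι) (x : (O i).Inv)
  /-- return `r`, keeping the local memory `m` for the next operation -/
  | ret (r : T.Res) (m : ℕ)

/-- The numerical code in which a program outputs an action. -/
def ProgramAction.code {ι : Type} [Primcodable ι] {O : ι → DataType.{u}} {T : DataType.{v}} :
    ProgramAction O T → ℕ ⊕ (ℕ × ℕ) ⊕ (ℕ × ℕ)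
  | .compute m => .inl m
  | .access i x => .inr (.inl (Encodable.encode i, Encodable.encode x))
  | .ret r m => .inr (.inr (Encodable.encode r, m))

/-- The program of one process. The content of the local memory (the tapes of a Turing machine) is
coded by a natural number, and what the program does is Turing computable. -/
structure Program {ι : Type} [Primcodable ι] (O : ι → DataType.{u}) (T : DataType.{v}) where
  /-- the local memory with which the process starts to execute an invocation -/
  start : ℕ → T.Inv → ℕ
  /-- the next action, depending on the local memory -/
  next : ℕ → ProgramAction O T
  /-- the local memory after an access to a shared object returned a value with the given code -/
  receive : ℕ → ℕ → ℕ
  start_computable : Computable₂ start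
  next_computable : Computable fun m => (next m).code
  receive_computable : Computable₂ receive

/-- An `n`-process implementation of an object of type `T` from the family `O` of linearizable
objects: a program for each process, the initial content of its local memory, and a state to which
each shared object is initialized, which may be any reachable state of that object. -/
structure Implementation (n : ℕ) {ι : Type} [Primcodable ι] (O : ι → DataType.{u})
    (T : DataType.{v}) where
  prog : Fin n → Program O T
  initMem : Fin n → ℕ
  initObj : ∀ i, (O i).State
  initObj_reachable : ∀ i, (O i).Reachable (initObj i)

/-- A configuration of the system: local memory of each process, whether it is executing an
operation, and the state of each shared object. -/
@[ext] structure Config (n : ℕ) {ι : Type} (O : ι → DataType.{u}) where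
  mem : Fin n → ℕ
  busy : Fin n → Bool
  obj : ∀ i, (O i).State

namespace Implementation

variable {n : ℕ} {ι : Type} [Primcodable ι] {O : ι → DataType.{u}} {T : DataType.{v}}

/-- The initial configuration. -/
def initConfig (A : Implementation n O T) : Config n O where
  mem := A.initMem
  busy := fun _ => false
  obj := A.initObj

open Classical in
/-- `A.Step c p e c'`: a step of process `p` leads from `c` to `c'`; `e` is the event of the
implemented object that happens in this step, if any. The shared objects are linearizable, so an
access to one of them takes effect, and returns, in one step. -/
inductive Step (A : Implementation n O T) :
    Config n O → Fin n → Option (Event n T) → Config n O → Prop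
  | invoke (c : Config n O) (p : Fin n) (x : T.Inv) (hidle : c.busy p = false) :
      Step A c p (some (.inv p x))
        { mem := Function.update c.mem p ((A.prog p).start (c.mem p) x)
          busy := Function.update c.busy p true
          obj := c.obj }
  | compute (c : Config n O) (p : Fin n) (m : ℕ) (hbusy : c.busy p = true)
      (hnext : (A.prog p).next (c.mem p) = .compute m) :
      Step A c p none
        { mem := Function.update c.mem p m
          busy := c.busy
          obj := c.obj }
  | access (c : Config n O) (p : Fin n) (i : ι) (x : (O i).Inv) (r : (O i).Res)
      (s : (O i).State) (hbusy : c.busy p = true)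
      (hnext : (A.prog p).next (c.mem p) = .access i x)
      (htrans : (O i).Trans (c.obj i) x r s) :
      Step A c p none
        { mem := Function.update c.mem p ((A.prog p).receive (c.mem p) (Encodable.encode r))
          busy := c.busy
          obj := Function.update c.obj i s }
  | ret (c : Config n O) (p : Fin n) (r : T.Res) (m : ℕ) (hbusy : c.busy p = true)
      (hnext : (A.prog p).next (c.mem p) = .ret r m) :
      Step A c p (some (.res p r))
        { mem := Function.update c.mem p m
          busy := Function.update c.busy p false
          obj := c.obj }

/-- A finite or infinite execution: at each time `k`, either the process `sched k = some p` takes a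
step, or (`sched k = none`) nothing happens. The processes are scheduled arbitrarily, and an idle
process may invoke any operation at any time. A finite execution is one in which nothing happens
from some time on. -/
structure Execution (A : Implementation n O T) where
  config : ℕ → Config n O
  sched : ℕ → Option (Fin n)
  history : History n T
  init : config 0 = A.initConfig
  step : ∀ k p, sched k = some p → A.Step (config k) p (history k) (config (k + 1))
  stay : ∀ k, sched k = none → history k = none ∧ config (k + 1) = config k

/-- Wait-freedom: whatever the other processes do, an operation of `p` terminates after finitely
many steps of `p`, i.e. it cannot be pending forever while `p` takes infinitely many steps. -/
def WaitFree (A : Implementation n O T) : Prop :=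
  ∀ (E : A.Execution) (p : Fin n) (x : T.Inv) (k : ℕ), E.history k = some (.inv p x) →
    (∀ m, ∃ j, m ≤ j ∧ E.sched j = some p) → ∃ k' r, E.history.Completes k k' p r

/-- Every history of the implementation is linearizable. -/
def Linearizable (A : Implementation n O T) : Prop :=
  ∀ E : A.Execution, E.history.Linearizable

/-- Every history of the implementation is eventually linearizable. -/
def EventuallyLinearizable (A : Implementation n O T) : Prop :=
  ∀ E : A.Execution, E.history.EventuallyLinearizable

end Implementation

/-!
An eventually linearizable implementation `A` of fetch-and-cons has a *stable* finite execution,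
from whose end on, at time `t`, all responses in all finite continuations are explained by a
sequential order that respects real time after `t`
(`Implementation.EventuallyLinearizable.exists_stable`). Otherwise every finite execution could be
continued to one that is not explained from the end of the former on, and the limit of iterated
continuations would be a history without a `t`-linearization for any `t`, since a
`t`-linearization can be cut down to explanations of the prefixes
(`History.TLinearizable.exists_explains`).

After a stable execution, the operations invoked before `t` may still be placed anywhere. To fix
them, let one process run alone while the others only finish their pending operations. The
linearization of this infinite history contains all early operations, so some later operation `k`
returns a list of exactly all operations invoked before `k`, when all other processes are idle
(`Implementation.exists_anchor`). The length of this list and the real-time order force every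
explanation of every continuation to start with just these operations followed by `k`
(`History.Explains.mem_take_iff`).

Hence the required implementation starts with the local memories and object states that `A` has
when `k` has returned, behaves as `A`, and removes from each response the final entries, which are
the values of the operations up to `k` (`Implementation.restart`, `History.Explains.shift`). Its
finite histories are linearizable, and the infinite ones are so by compactness
(`History.linearizable_of_forall_explains`): the length of a response is the position of its
operation, so that only finitely many operations compete for each position.
-/

/-! ### Events and time -/

namespace History

section Time

variable {n : ℕ} {T : DataType.{u}}

theorem exists_forall_inSuffix (H : History n T) (t : ℕ) :
    ∃ t₀, ∀ k, t₀ ≤ k → (H k).isSome = true → H.InSuffix t k := by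
  induction t with
  | zero => exact ⟨0, fun k _ _ => Nat.zero_le _⟩
  | succ t ih =>
    obtain ⟨t₀, h₀⟩ := ih
    by_cases hex : ∃ k, t₀ ≤ k ∧ (H k).isSome = true
    · obtain ⟨k, hk, hks⟩ := hex
      refine ⟨k + 1, fun i hi _ => ?_⟩
      have h1 : t ≤ Nat.count (fun j => (H j).isSome = true) k := h₀ k hk hks
      have h2 := Nat.count_monotone (fun j => (H j).isSome = true) hi
      rw [Nat.count_succ, if_pos hks] at h2
      exact le_trans (Nat.succ_le_succ h1) h2
    · exact ⟨t₀, fun k hk hs => absurd ⟨k, hk, hs⟩ hex⟩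

theorem Completes.congr {H H' : History n T} {m k k' : ℕ} {p : Fin n} {r : T.Res}
    (h : H.Completes k k' p r) (hm : k' < m) (heq : ∀ i, i < m → H i = H' i) :
    H'.Completes k k' p r := by
  obtain ⟨⟨x, hx⟩, hlt, hr, hno⟩ := h
  refine ⟨⟨x, ?_⟩, hlt, ?_, fun j h1 h2 e he => hno j h1 h2 e ?_⟩
  · rw [← heq k (by omega), hx]
  · rw [← heq k' hm, hr]
  · rw [heq j (by omega), he]

end Time

variable {n : ℕ} {V : Type} [Primcodable V] {H H' : History n (fetchAndCons V)}

/-! ### Explanations of finite parts of a history -/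

/-- The value that is added by the operation invoked at time `k`, if `k` is the time of an
invocation. -/
def value (H : History n (fetchAndCons V)) (k : ℕ) : Option V :=
  match H k with
  | some (.inv _ x) => some x
  | _ => none

theorem value_eq_some {k : ℕ} {x : V} :
    H.value k = some x ↔ ∃ p, H k = some (.inv p x) := by
  unfold value
  constructor
  · intro h
    split at h
    · next q y hy =>
      obtain rfl : y = x := by simpa using h
      exact ⟨q, hy⟩
    · cases h
  · rintro ⟨p, h⟩
    rw [h]

theorem isSome_value {k : ℕ} :
    (H.value k).isSome = true ↔ ∃ p x, H k = some (.inv p x) := by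
  rw [Option.isSome_iff_exists]
  constructor
  · rintro ⟨x, hx⟩
    obtain ⟨p, hp⟩ := value_eq_some.1 hx
    exact ⟨p, x, hp⟩
  · rintro ⟨p, x, hp⟩
    exact ⟨x, value_eq_some.2 ⟨p, hp⟩⟩

/-- The list that is stored after the operations of `l`, given by their invocation times, have been
applied one after the other to the empty list. -/
def contents (H : History n (fetchAndCons V)) (l : List ℕ) : List V :=
  l.reverse.filterMap H.value

@[simp] theorem contents_nil : H.contents [] = [] := rfl

theorem contents_append (l l' : List ℕ) :
    H.contents (l ++ l') = H.contents l' ++ H.contents l := by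
  simp [contents]

theorem contents_concat {l : List ℕ} {k : ℕ} {x : V} (h : H.value k = some x) :
    H.contents (l ++ [k]) = x :: H.contents l := by
  rw [contents_append]
  simp [contents, h]

theorem length_contents {l : List ℕ} (h : ∀ k ∈ l, (H.value k).isSome = true) :
    (H.contents l).length = l.length := by
  induction l using List.reverseRecOn with
  | nil => rfl
  | append_singleton l k ih =>
    obtain ⟨x, hx⟩ := Option.isSome_iff_exists.1 (h k (by simp))
    rw [contents_concat hx, List.length_cons, List.length_append,
      ih fun i hi => h i (by simp [hi]), List.length_singleton]

/-- The operations of `l` (given by their invocation times, all before `m`), executed in this order,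
explain the responses of `H` at the times in `[t, m)`, and respect the real-time order from `t` on.
In contrast to `History.IsLinearization`, an operation that returns before `t` need not be in `l`,
which makes the notion stable under taking prefixes and limits. -/
structure Explains (H : History n (fetchAndCons V)) (t m : ℕ) (l : List ℕ) : Prop where
  nodup : l.Nodup
  lt : ∀ k ∈ l, k < m
  invoked : ∀ k ∈ l, (H.value k).isSome = true
  /-- An operation that returns a list of length `j` is in position `j`, and the list consists of
  the values of the operations before it. -/
  same : ∀ k k' p (r : List V), H.Completes k k' p r → t ≤ k' → k' < m →
    l[r.length]? = some k ∧ H.contents (l.take r.length) = r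
  order : ∀ k₁ k₁' p (r : List V) k₂ j, H.Completes k₁ k₁' p r → t ≤ k₁' → k₁' < m → k₁' < k₂ →
    l[j]? = some k₂ → r.length < j

theorem Explains.congr {t m : ℕ} {l : List ℕ} (h : H.Explains t m l)
    (heq : ∀ i, i < m → H i = H' i) : H'.Explains t m l := by
  have hv : ∀ k, k < m → H.value k = H'.value k := fun k hk => by
    unfold value; rw [heq k hk]
  have hC : ∀ {k k' p} {r : List V}, k' < m → H'.Completes k k' p r → H.Completes k k' p r :=
    fun hk hc => hc.congr hk fun i hi => (heq i hi).symm
  refine ⟨h.nodup, h.lt, fun k hk => ?_, fun k k' p r hc ht hm => ?_,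
    fun k₁ k₁' p r k₂ j hc ht hm => h.order k₁ k₁' p r k₂ j (hC hm hc) ht hm⟩
  · rw [← hv k (h.lt k hk)]
    exact h.invoked k hk
  · obtain ⟨h1, h2⟩ := h.same k k' p r (hC hm hc) ht hm
    refine ⟨h1, ?_⟩
    rw [← h2, h2]
    conv_rhs => rw [← h2]
    exact List.filterMap_congr fun k hk =>
      (hv k (h.lt k (List.mem_of_mem_take (List.mem_reverse.1 hk)))).symm

theorem explains_nil (H : History n (fetchAndCons V)) (t : ℕ) : H.Explains t t [] :=
  ⟨List.nodup_nil, by simp, by simp, fun k k' p r _ h1 h2 => by omega, by simp⟩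

/-! ### From linearizations to explanations -/

section Slots

/-- The operations, given by their invocation times, in the slots of `S` before slot `j`. -/
def slots {α : Type*} (S : ℕ → Option (ℕ × α)) (j : ℕ) : List ℕ :=
  (List.range j).filterMap fun i => (S i).map Prod.fst

theorem mem_slots {α : Type*} {S : ℕ → Option (ℕ × α)} {j k : ℕ} :
    k ∈ slots S j ↔ ∃ i r, i < j ∧ S i = some (k, r) := by
  simp only [slots, List.mem_filterMap, List.mem_range, Option.map_eq_some_iff]
  constructor
  · rintro ⟨i, hi, ⟨k, r⟩, h, rfl⟩
    exact ⟨i, r, hi, h⟩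
  · rintro ⟨i, r, hi, h⟩
    exact ⟨i, hi, (k, r), h, rfl⟩

theorem slots_succ {α : Type*} (S : ℕ → Option (ℕ × α)) (j : ℕ) :
    slots S (j + 1) = slots S j ++ ((S j).map Prod.fst).toList := by
  rw [slots, List.range_succ, List.filterMap_append, ← slots]
  cases hj : S j <;> simp [hj]

theorem slots_prefix {α : Type*} (S : ℕ → Option (ℕ × α)) {i j : ℕ} (h : i ≤ j) :
    slots S i <+: slots S j := by
  induction h with
  | refl => exact List.prefix_rfl
  | step _ ih => exact ih.trans (by rw [slots_succ]; exact List.prefix_append _ _)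

variable {S : ℕ → Option (ℕ × List V)}

theorem Legal.nodup_slots (h : H.Legal S) (j : ℕ) : (slots S j).Nodup := by
  refine List.Nodup.filterMap (fun a a' b hb hb' => ?_) List.nodup_range
  simp only [Option.mem_def, Option.map_eq_some_iff] at hb hb'
  obtain ⟨⟨k, r⟩, h1, rfl⟩ := hb
  obtain ⟨⟨k', r'⟩, h2, h3⟩ := hb'
  obtain rfl : k' = k := h3
  exact h.1 a a' _ r r' h1 h2

theorem Legal.isSome_value (h : H.Legal S) {j k : ℕ} {r : List V} (hS : S j = some (k, r)) :
    (H.value k).isSome = true := by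
  obtain ⟨-, σ, -, -, h⟩ := h
  obtain ⟨p, x, hx, -⟩ := h j k r hS
  exact History.isSome_value.2 ⟨p, x, hx⟩

theorem Legal.isSome_value_of_mem (h : H.Legal S) {j k : ℕ} (hk : k ∈ slots S j) :
    (H.value k).isSome = true := by
  obtain ⟨i, r, -, hS⟩ := mem_slots.1 hk
  exact h.isSome_value hS

theorem Legal.contents_slots (h : H.Legal S) {j k : ℕ} {r : List V} (hS : S j = some (k, r)) :
    H.contents (slots S j) = r := by
  obtain ⟨-, σ, h0, hnone, hsome⟩ := h
  have key : ∀ i, H.contents (slots S i) = σ i := by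
    intro i
    induction i with
    | zero => exact (Set.mem_singleton_iff.1 h0).symm
    | succ i ih =>
      rw [slots_succ]
      cases hi : S i with
      | none => simp [ih, hnone i hi]
      | some a =>
        obtain ⟨k, r⟩ := a
        obtain ⟨p, x, hx, -, hσ⟩ := hsome i k r hi
        rw [hσ, ← ih]
        exact contents_concat (value_eq_some.2 ⟨p, hx⟩)
  obtain ⟨p, x, hx, hr, -⟩ := hsome j k r hS
  rw [key]
  exact hr.symm

theorem Legal.length_slots (h : H.Legal S) {j k : ℕ} {r : List V} (hS : S j = some (k, r)) :
    (slots S j).length = r.length := by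
  rw [← h.contents_slots hS, length_contents fun k hk => h.isSome_value_of_mem hk]

theorem Legal.slots_eq_take (h : H.Legal S) {i j k : ℕ} {r : List V} (hS : S i = some (k, r))
    (hij : i < j) : (slots S j)[r.length]? = some k ∧ (slots S j).take r.length = slots S i := by
  obtain ⟨l, hl⟩ := slots_prefix S (Nat.succ_le_of_lt hij)
  rw [Nat.succ_eq_add_one, slots_succ, hS] at hl
  rw [← hl, ← h.length_slots hS]
  simp

end Slots

/-- The truncation of a linearization after the last operation that returns in `[t, m)` explains
these responses: by the real-time order, no operation that is invoked after `m` can precede the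
truncation point. -/
theorem TLinearizable.exists_explains {t : ℕ} (h : H.TLinearizable t) :
    ∃ t₀, ∀ t' m, t₀ ≤ t' → ∃ l, H.Explains t' m l := by
  classical
  obtain ⟨S, hS⟩ := h
  obtain ⟨t₀, ht₀⟩ := H.exists_forall_inSuffix t
  refine ⟨t₀, fun t' m htt => ?_⟩
  have hres : ∀ {k k' p} {r : List V}, H.Completes k k' p r → t' ≤ k' → H.InSuffix t k' :=
    fun hc hk => ht₀ _ (htt.trans hk) (by rw [hc.2.2.1]; rfl)
  have hinv : ∀ {j k} {r : List V}, S j = some (k, r) → t' ≤ k → H.InSuffix t k := by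
    intro j k r hj hk
    obtain ⟨p, x, hx⟩ := isSome_value.1 (hS.legal.isSome_value hj)
    exact ht₀ _ (htt.trans hk) (by rw [hx]; rfl)
  have hord : ∀ {k k' p} {r : List V} {k₂ i j} {r₂ : List V}, H.Completes k k' p r → t' ≤ k' →
      k' < k₂ → S i = some (k, r) → S j = some (k₂, r₂) → i < j := by
    intro k k' p r k₂ i j r₂ hc ht hlt hi hj
    obtain ⟨i', r', hij, hi'⟩ := hS.order k k' p r k₂ j r₂ hc hlt (hres hc ht)
      (hinv hj (ht.trans hlt.le)) hj
    rwa [hS.legal.1 i i' k r r' hi hi']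
  have hex : ∃ J, ∀ k k' p (r : List V) j, H.Completes k k' p r → t' ≤ k' → k' < m →
      S j = some (k, r) → j < J := by
    choose f hf using fun k : ℕ =>
      (show ∃ J, ∀ j r, S j = some (k, r) → j < J by
        by_cases h : ∃ j r, S j = some (k, r)
        · obtain ⟨j, r, h⟩ := h
          exact ⟨j + 1, fun i r' h' => by rw [hS.legal.1 i j k r' r h' h]; omega⟩
        · exact ⟨0, fun j r hj => absurd ⟨j, r, hj⟩ h⟩)
    refine ⟨(Finset.range m).sup f, fun k k' p r j hc _ hm hj => (hf k j r hj).trans_le ?_⟩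
    exact Finset.le_sup (f := f) (Finset.mem_range.2 (hc.2.1.trans hm))
  obtain ⟨J, hJ, hmin⟩ : ∃ J, (∀ k k' p (r : List V) j, H.Completes k k' p r → t' ≤ k' → k' < m →
      S j = some (k, r) → j < J) ∧ ∀ i, i < J → ∃ k k' p, ∃ r : List V, ∃ j,
      H.Completes k k' p r ∧ t' ≤ k' ∧ k' < m ∧ S j = some (k, r) ∧ i ≤ j := by
    refine ⟨Nat.find hex, Nat.find_spec hex, fun i hi => ?_⟩
    have := Nat.find_min hex hi
    push Not at this
    obtain ⟨k, k', p, r, j, h1, h2, h3, h4, h5⟩ := this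
    exact ⟨k, k', p, r, j, h1, h2, h3, h4, h5⟩
  refine ⟨slots S J, hS.legal.nodup_slots J, fun k hk => ?_,
    fun k hk => hS.legal.isSome_value_of_mem hk, fun k k' p r hc ht hm => ?_,
    fun k₁ k₁' p r k₂ j hc ht hm hlt hj => ?_⟩
  · obtain ⟨i, r, hi, hSi⟩ := mem_slots.1 hk
    obtain ⟨k₁, k₁', p, r₁, j, hc, h2, h3, h4, h5⟩ := hmin i hi
    by_contra hcon
    exact absurd (hord hc h2 (by omega) h4 hSi) (by omega)
  · obtain ⟨i, hi⟩ := hS.same k k' p r hc (hres hc ht)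
    obtain ⟨h1, h2⟩ := hS.legal.slots_eq_take hi (hJ k k' p r i hc ht hm hi)
    exact ⟨h1, by rw [h2, hS.legal.contents_slots hi]⟩
  · obtain ⟨i, hi⟩ := hS.same k₁ k₁' p r hc (hres hc ht)
    obtain ⟨i₂, r₂, hi₂, hSi₂⟩ := mem_slots.1 (List.mem_of_getElem? hj)
    have hlt' := hord hc ht hlt hi hSi₂
    obtain ⟨h1, -⟩ := hS.legal.slots_eq_take hSi₂ hi₂
    have hnd := hS.legal.nodup_slots J
    have hjr : j = r₂.length := by
      obtain ⟨ha, hb⟩ := List.getElem?_eq_some_iff.1 hj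
      obtain ⟨hc, hd⟩ := List.getElem?_eq_some_iff.1 h1
      exact (hnd.getElem_inj_iff).1 (hb.trans hd.symm)
    obtain ⟨h3, -⟩ := hS.legal.slots_eq_take hi hlt'
    obtain ⟨h4, -⟩ := List.getElem?_eq_some_iff.1 h3
    rw [hjr, ← hS.legal.length_slots hSi₂]
    exact h4

/-! ### From explanations to a linearization -/

/-- If all finite prefixes have explanations then so has the whole history. The operation in a
position `j` is the limit of those in position `j` of the explanations along an ultrafilter; there
are only finitely many candidates, as soon as an operation returns a list of length at least `j`,
because none of them can be invoked after this response. -/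
theorem linearizable_of_forall_explains (h : ∀ m, ∃ l, H.Explains 0 m l) : H.Linearizable := by
  classical
  choose l hl using h
  let U : Ultrafilter ℕ := Filter.hyperfilter ℕ
  have hU : ∀ k, ∀ᶠ m in (U : Filter ℕ), k < m := fun k =>
    Filter.Tendsto.eventually (Nat.hyperfilter_le_atTop) (Filter.eventually_gt_atTop k)
  let good : ℕ → Prop := fun j => ∃ k k' p, ∃ r : List V, H.Completes k k' p r ∧ j ≤ r.length
  have hlim : ∀ j, ∃ a, good j → ∀ᶠ m in (U : Filter ℕ), (l m)[j]? = some a := by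
    intro j
    by_cases hg : good j
    swap
    · exact ⟨0, fun h => absurd h hg⟩
    obtain ⟨k, k', p, r, hc, hj⟩ := hg
    have : ∀ᶠ m in (U : Filter ℕ), ∃ a ∈ Set.Iic k', (l m)[j]? = some a := by
      filter_upwards [hU k'] with m hm
      obtain ⟨h1, -⟩ := List.getElem?_eq_some_iff.1 ((hl m).same k k' p r hc (Nat.zero_le _) hm).1
      have h2 : (l m)[j]? = some ((l m)[j]'(hj.trans_lt h1)) := List.getElem?_eq_getElem _
      refine ⟨_, ?_, h2⟩
      by_contra hcon
      have := (hl m).order k k' p r _ j hc (Nat.zero_le _) hm (not_le.1 hcon) h2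
      omega
    obtain ⟨a, -, ha⟩ := (Ultrafilter.eventually_exists_mem_iff (Set.finite_Iic k')).1 this
    exact ⟨a, fun _ => ha⟩
  choose a ha using hlim
  have hgood : ∀ {i j}, i ≤ j → good j → good i := by
    rintro i j hij ⟨k, k', p, r, hc, hj⟩
    exact ⟨k, k', p, r, hc, hij.trans hj⟩
  have hcomp : ∀ {k k' p} {r : List V}, H.Completes k k' p r → good r.length :=
    fun {k k' p r} hc => ⟨k, k', p, r, hc, le_rfl⟩
  have ha_eq : ∀ {k k' p} {r : List V}, H.Completes k k' p r → a r.length = k := by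
    intro k k' p r hc
    obtain ⟨m, h1, h2⟩ := ((ha _ (hcomp hc)).and (hU k')).exists
    have := ((hl m).same k k' p r hc (Nat.zero_le _) h2).1
    exact Option.some_injective _ (h1.symm.trans this)
  have hval : ∀ j, good j → (H.value (a j)).isSome = true := by
    intro j hj
    obtain ⟨m, h1⟩ := (ha j hj).exists
    exact (hl m).invoked _ (List.mem_of_getElem? h1)
  let σ : ℕ → List V := fun j => H.contents (((List.range j).filter fun i => good i).map a)
  have hσ_of_good : ∀ j, good j → σ (j + 1) = H.contents (((List.range j).filter fun i =>
      good i).map a ++ [a j]) := by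
    intro j hj
    simp [σ, List.range_succ, hj]
  have hσ : ∀ {k k' p} {r : List V}, H.Completes k k' p r → σ r.length = r := by
    intro k k' p r hc
    have hall : ∀ᶠ m in (U : Filter ℕ), ∀ j ∈ Set.Iio r.length, (l m)[j]? = some (a j) :=
      (Filter.eventually_all_finite (Set.finite_Iio _)).2 fun j hj =>
        ha j (hgood (le_of_lt hj) (hcomp hc))
    obtain ⟨m, h1, h2⟩ := (hall.and (hU k')).exists
    obtain ⟨h3, h4⟩ := (hl m).same k k' p r hc (Nat.zero_le _) h2
    rw [← h4]
    have : ((List.range r.length).filter fun i => good i) = List.range r.length := by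
      rw [List.filter_eq_self]
      intro i hi
      simpa using hgood (le_of_lt (List.mem_range.1 hi)) (hcomp hc)
    simp only [σ, h4]
    rw [this]
    conv_rhs => rw [← h4]
    congr 1
    obtain ⟨h5, -⟩ := List.getElem?_eq_some_iff.1 h3
    refine List.ext_getElem (by simp; omega) fun i hi hi' => ?_
    have hir : i < r.length := by simpa using hi
    obtain ⟨h6, h7⟩ := List.getElem?_eq_some_iff.1 (h1 i hir)
    simp [h7]
  let S : ℕ → Option (ℕ × List V) := fun j => if good j then some (a j, σ j) else none
  have hS : ∀ {j k} {r : List V}, S j = some (k, r) ↔ good j ∧ a j = k ∧ σ j = r := by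
    intro j k r
    by_cases hj : good j <;> simp [S, hj]
  have hsame : ∀ {k k' p} {r : List V}, H.Completes k k' p r → S r.length = some (k, r) :=
    fun hc => hS.2 ⟨hcomp hc, ha_eq hc, hσ hc⟩
  refine ⟨S, ⟨⟨?_, σ, rfl, ?_, ?_⟩, fun k k' p r hc => ⟨_, _, hsame hc⟩, ?_,
    fun k k' p r hc _ => ⟨_, hsame hc⟩⟩⟩
  · intro i j k r r' hi hj
    obtain ⟨gi, rfl, -⟩ := hS.1 hi
    obtain ⟨gj, hij, -⟩ := hS.1 hj
    obtain ⟨m, h1, h2⟩ := ((ha i gi).and (ha j gj)).exists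
    rw [hij] at h2
    obtain ⟨h3, h4⟩ := List.getElem?_eq_some_iff.1 h1
    obtain ⟨h5, h6⟩ := List.getElem?_eq_some_iff.1 h2
    exact ((hl m).nodup.getElem_inj_iff).1 (h4.trans h6.symm)
  · intro j hj
    have : ¬ good j := fun hg => by simp [S, hg] at hj
    simp [σ, List.range_succ, this]
  · intro j k r hj
    obtain ⟨gj, rfl, rfl⟩ := hS.1 hj
    obtain ⟨p, x, hx⟩ := isSome_value.1 (hval j gj)
    refine ⟨p, x, hx, rfl, ?_⟩
    rw [hσ_of_good j gj]
    exact contents_concat (value_eq_some.2 ⟨p, hx⟩)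
  · intro k₁ k₁' p₁ r₁ k₂ j₂ r₂ hc hlt _ _ hj
    obtain ⟨gj, rfl, -⟩ := hS.1 hj
    obtain ⟨m, h1, h2⟩ := ((ha j₂ gj).and (hU k₁')).exists
    exact ⟨_, _, (hl m).order k₁ k₁' p₁ r₁ _ j₂ hc (Nat.zero_le _) h2 hlt h1, hsame hc⟩

end History

/-! ### Continuations and limits of executions -/

namespace Implementation

variable {n : ℕ} {ι : Type} [Primcodable ι] {O : ι → DataType.{u}} {T : DataType.{v}}
  {A : Implementation n O T}

theorem Step.busy_eq {c c' : Config n O} {p q : Fin n} {e : Option (Event n T)}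
    (h : A.Step c p e c') (hq : ∀ e', e = some e' → e'.proc ≠ q) : c'.busy q = c.busy q := by
  cases h with
  | invoke x hidle =>
    have : q ≠ p := fun h => hq _ rfl h.symm
    simp [this]
  | compute m hb hn => rfl
  | access i x r s hb hn ht => rfl
  | ret r m hb hn =>
    have : q ≠ p := fun h => hq _ rfl h.symm
    simp [this]

theorem Step.of_inv {c c' : Config n O} {p q : Fin n} {x : T.Inv}
    (h : A.Step c p (some (.inv q x)) c') : c.busy q = false ∧ c'.busy q = true := by
  cases h with
  | invoke x hidle => exact ⟨hidle, by simp⟩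

theorem Step.of_res {c c' : Config n O} {p q : Fin n} {r : T.Res}
    (h : A.Step c p (some (.res q r)) c') : c.busy q = true ∧ c'.busy q = false := by
  cases h with
  | ret r m hb hn => exact ⟨hb, by simp⟩

theorem Step.proc_eq {c c' : Config n O} {p : Fin n} {e : Event n T}
    (h : A.Step c p (some e) c') : e.proc = p := by
  cases h <;> rfl

theorem exists_step_of_busy (A : Implementation n O T) {c : Config n O} {p : Fin n}
    (h : c.busy p = true) : ∃ e c', A.Step c p e c' := by
  classical
  cases hn : (A.prog p).next (c.mem p) with
  | compute m => exact ⟨_, _, .compute c p m h hn⟩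
  | access i x =>
    obtain ⟨r, s, ht⟩ := (O i).total (c.obj i) x
    exact ⟨_, _, .access c p i x r s h hn ht⟩
  | ret r m => exact ⟨_, _, .ret c p r m h hn⟩

theorem Step.obj_reachable {c c' : Config n O} {p : Fin n} {e : Option (Event n T)}
    (h : A.Step c p e c') (hc : ∀ i, (O i).Reachable (c.obj i)) (i : ι) :
    (O i).Reachable (c'.obj i) := by
  cases h with
  | invoke x hidle => exact hc i
  | compute m hb hn => exact hc i
  | access j x r s hb hn ht =>
    by_cases hij : i = j
    · subst hij
      obtain ⟨s₀, h₀, hs⟩ := hc i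
      simp only [Function.update_self]
      exact ⟨s₀, h₀, hs.tail ⟨x, r, ht⟩⟩
    · simpa [hij] using hc i
  | ret r m hb hn => exact hc i

/-- A sequence of configurations, scheduling decisions and events that follows the programs of `A`,
starting from an arbitrary configuration. -/
structure IsRun (A : Implementation n O T) (config : ℕ → Config n O) (sched : ℕ → Option (Fin n))
    (history : History n T) : Prop where
  step : ∀ k p, sched k = some p → A.Step (config k) p (history k) (config (k + 1))
  stay : ∀ k, sched k = none → history k = none ∧ config (k + 1) = config k

namespace Execution

/-- The executions `E` and `F` coincide up to time `m`. -/
structure Agree (E F : A.Execution) (m : ℕ) : Prop where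
  config : ∀ k, k ≤ m → E.config k = F.config k
  sched : ∀ k, k < m → E.sched k = F.sched k
  history : ∀ k, k < m → E.history k = F.history k

theorem Agree.refl (E : A.Execution) (m : ℕ) : Agree E E m :=
  ⟨fun _ _ => rfl, fun _ _ => rfl, fun _ _ => rfl⟩

theorem Agree.trans {E F G : A.Execution} {m : ℕ} (h : Agree E F m) (h' : Agree F G m) :
    Agree E G m :=
  ⟨fun k hk => (h.config k hk).trans (h'.config k hk),
    fun k hk => (h.sched k hk).trans (h'.sched k hk),
    fun k hk => (h.history k hk).trans (h'.history k hk)⟩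

theorem Agree.mono {E F : A.Execution} {m m' : ℕ} (h : Agree E F m) (hm : m' ≤ m) :
    Agree E F m' :=
  ⟨fun k hk => h.config k (hk.trans hm), fun k hk => h.sched k (hk.trans_le hm),
    fun k hk => h.history k (hk.trans_le hm)⟩

/-- A finite execution, given as the part of `E` up to time `m`, can be continued by any run from
its last configuration. -/
theorem exists_splice (E : A.Execution) (m : ℕ) {config : ℕ → Config n O}
    {sched : ℕ → Option (Fin n)} {history : History n T} (h : A.IsRun config sched history)
    (h0 : config 0 = E.config m) :
    ∃ F : A.Execution, Agree E F m ∧ (∀ k, F.config (m + k) = config k) ∧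
      (∀ k, F.sched (m + k) = sched k) ∧ ∀ k, F.history (m + k) = history k := by
  let config' : ℕ → Config n O := fun k => if k < m then E.config k else config (k - m)
  let sched' : ℕ → Option (Fin n) := fun k => if k < m then E.sched k else sched (k - m)
  let history' : History n T := fun k => if k < m then E.history k else history (k - m)
  have hc1 : ∀ k, k ≤ m → config' k = E.config k := fun k hk => by
    rcases hk.lt_or_eq with hk | rfl
    · simp [config', hk]
    · simp [config', h0]
  have hs1 : ∀ k, k < m → sched' k = E.sched k := fun k hk => by simp [sched', hk]
  have hh1 : ∀ k, k < m → history' k = E.history k := fun k hk => by simp [history', hk]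
  have hc2 : ∀ k, config' (m + k) = config k := fun k => by simp [config']
  have hs2 : ∀ k, sched' (m + k) = sched k := fun k => by simp [sched']
  have hh2 : ∀ k, history' (m + k) = history k := fun k => by simp [history']
  refine ⟨⟨config', sched', history', ?_, fun k p hk => ?_, fun k hk => ?_⟩,
    ⟨fun k hk => (hc1 k hk).symm, fun k hk => (hs1 k hk).symm, fun k hk => (hh1 k hk).symm⟩,
    hc2, hs2, hh2⟩
  · rw [hc1 0 (Nat.zero_le _), E.init]
  · rcases lt_or_ge k m with hkm | hkm
    · rw [hs1 k hkm] at hk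
      rw [hc1 k hkm.le, hh1 k hkm, hc1 (k + 1) hkm]
      exact E.step k p hk
    · obtain ⟨j, rfl⟩ := Nat.exists_eq_add_of_le hkm
      rw [hs2] at hk
      rw [hc2, hh2, Nat.add_assoc, hc2]
      exact h.step j p hk
  · rcases lt_or_ge k m with hkm | hkm
    · rw [hs1 k hkm] at hk
      rw [hc1 k hkm.le, hh1 k hkm, hc1 (k + 1) hkm]
      exact E.stay k hk
    · obtain ⟨j, rfl⟩ := Nat.exists_eq_add_of_le hkm
      rw [hs2] at hk
      rw [hc2, hh2, Nat.add_assoc, hc2]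
      exact h.stay j hk

/-- Longer and longer finite executions, each extending the previous one, have a limit. -/
theorem exists_limit (E : ℕ → A.Execution) (m : ℕ → ℕ) (hm : StrictMono m)
    (hE : ∀ i, Agree (E i) (E (i + 1)) (m i)) :
    ∃ F : A.Execution, ∀ i, Agree (E i) F (m i) := by
  have hle : ∀ i j, i ≤ j → Agree (E i) (E j) (m i) := by
    intro i j hij
    induction hij with
    | refl => exact Agree.refl _ _
    | step hij ih => exact ih.trans ((hE _).mono (hm.monotone hij))
  have hid : ∀ k, k < m (k + 1) := fun k => hm.le_apply.trans_lt (hm (Nat.lt_succ_self k))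
  have hany : ∀ i j k, k < m i → k < m j → ∃ G, Agree (E i) G (k + 1) ∧ Agree (E j) G (k + 1) :=
    fun i j k hi hj => ⟨E (max i j), (hle i _ (le_max_left _ _)).mono hi,
      (hle j _ (le_max_right _ _)).mono hj⟩
  have hc : ∀ i j k, k < m i → k < m j → (E i).config k = (E j).config k := fun i j k hi hj => by
    obtain ⟨G, h1, h2⟩ := hany i j k hi hj
    rw [h1.config k (by omega), h2.config k (by omega)]
  have hs : ∀ i j k, k < m i → k < m j → (E i).sched k = (E j).sched k := fun i j k hi hj => by
    obtain ⟨G, h1, h2⟩ := hany i j k hi hj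
    rw [h1.sched k (by omega), h2.sched k (by omega)]
  have hh : ∀ i j k, k < m i → k < m j → (E i).history k = (E j).history k := fun i j k hi hj => by
    obtain ⟨G, h1, h2⟩ := hany i j k hi hj
    rw [h1.history k (by omega), h2.history k (by omega)]
  have hc' : ∀ k, (E (k + 1 + 1)).config (k + 1) = (E (k + 1)).config (k + 1) := fun k =>
    ((hE (k + 1)).config (k + 1) hm.le_apply).symm
  refine ⟨⟨fun k => (E (k + 1)).config k, fun k => (E (k + 1)).sched k,
    fun k => (E (k + 1)).history k, (E 1).init, fun k p hk => ?_, fun k hk => ?_⟩,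
    fun i => ⟨fun k hk => ?_, fun k hk => hs _ _ k hk (hid k), fun k hk => hh _ _ k hk (hid k)⟩⟩
  · rw [hc']
    exact (E (k + 1)).step k p hk
  · rw [hc']
    exact (E (k + 1)).stay k hk
  · have : k < m (i + 1) := hk.trans_lt (hm (Nat.lt_succ_self i))
    rw [(hE i).config k hk]
    exact hc _ _ k this (hid k)

variable (E : A.Execution)

theorem exists_step_of_history {k : ℕ} {e : Event n T} (h : E.history k = some e) :
    ∃ p, E.sched k = some p ∧ A.Step (E.config k) p (some e) (E.config (k + 1)) := by
  cases hs : E.sched k with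
  | none => rw [(E.stay k hs).1] at h; cases h
  | some p => exact ⟨p, rfl, h ▸ E.step k p hs⟩

theorem busy_succ_eq {k : ℕ} {q : Fin n} (hq : ∀ e, E.history k = some e → e.proc ≠ q) :
    (E.config (k + 1)).busy q = (E.config k).busy q := by
  cases hs : E.sched k with
  | none => rw [(E.stay k hs).2]
  | some p => exact (E.step k p hs).busy_eq hq

theorem busy_eq_of_le {i k : ℕ} {q : Fin n} (hik : i ≤ k)
    (hq : ∀ j, i ≤ j → j < k → ∀ e, E.history j = some e → e.proc ≠ q) :
    (E.config k).busy q = (E.config i).busy q := by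
  induction hik with
  | refl => rfl
  | step hik ih =>
    rw [E.busy_succ_eq (hq _ hik (Nat.lt_succ_self _)),
      ih fun j h1 h2 => hq j h1 (h2.trans (Nat.lt_succ_self _))]

theorem busy_of_inv {k : ℕ} {p : Fin n} {x : T.Inv} (h : E.history k = some (.inv p x)) :
    (E.config k).busy p = false ∧ (E.config (k + 1)).busy p = true := by
  obtain ⟨q, -, hs⟩ := E.exists_step_of_history h
  exact hs.of_inv

theorem busy_of_res {k : ℕ} {p : Fin n} {r : T.Res} (h : E.history k = some (.res p r)) :
    (E.config k).busy p = true ∧ (E.config (k + 1)).busy p = false := by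
  obtain ⟨q, -, hs⟩ := E.exists_step_of_history h
  exact hs.of_res

theorem idle_of_no_inv {i k : ℕ} {p : Fin n} (hik : i ≤ k) (hidle : (E.config i).busy p = false)
    (hno : ∀ j x, i ≤ j → j < k → E.history j ≠ some (.inv p x)) :
    (E.config k).busy p = false := by
  induction hik with
  | refl => exact hidle
  | @step k hik ih =>
    have hk := ih fun j x h1 h2 => hno j x h1 (h2.trans (Nat.lt_succ_self _))
    rw [E.busy_succ_eq, hk]
    rintro (⟨q, x⟩ | ⟨q, r⟩) he rfl
    · exact hno k x hik (Nat.lt_succ_self _) he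
    · exact absurd (hk.symm.trans (E.busy_of_res he).1) (by simp)

/-- An operation of a process that is idle later on has been completed. -/
theorem exists_completes_of_idle {i k : ℕ} {p : Fin n} {x : T.Inv}
    (h : E.history i = some (.inv p x)) (hik : i < k) (hidle : (E.config k).busy p = false) :
    ∃ k' r, k' < k ∧ E.history.Completes i k' p r := by
  classical
  have hex : ∃ j, i < j ∧ j < k ∧ ∃ e, E.history j = some e ∧ e.proc = p := by
    by_contra hcon
    push Not at hcon
    have := E.busy_eq_of_le (q := p) (Nat.succ_le_of_lt hik)
      fun j h1 h2 e he => hcon j h1 h2 e he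
    rw [(E.busy_of_inv h).2, hidle] at this
    cases this
  obtain ⟨h1, h2, e, he, hep⟩ := Nat.find_spec hex
  set k' := Nat.find hex
  have hno : ∀ j, i < j → j < k' → ∀ e, E.history j = some e → e.proc ≠ p :=
    fun j h3 h4 e he hp => Nat.find_min hex h4 ⟨h3, h4.trans h2, e, he, hp⟩
  have hbusy := E.busy_eq_of_le (q := p) (Nat.succ_le_of_lt h1) fun j h3 h4 => hno j h3 h4
  rw [(E.busy_of_inv h).2] at hbusy
  cases e with
  | inv q y =>
    obtain rfl : q = p := hep
    rw [(E.busy_of_inv he).1] at hbusy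
    cases hbusy
  | res q r =>
    obtain rfl : q = p := hep
    exact ⟨k', r, h2, ⟨x, h⟩, h1, he, hno⟩

/-- A busy process has a pending operation. -/
theorem exists_pending_of_busy {k : ℕ} {p : Fin n} (h : (E.config k).busy p = true) :
    ∃ i x, i < k ∧ E.history i = some (.inv p x) ∧
      ∀ j, i < j → j < k → ∀ e, E.history j = some e → e.proc ≠ p := by
  induction k with
  | zero =>
    rw [E.init] at h
    cases h
  | succ k ih =>
    by_cases hev : ∃ e, E.history k = some e ∧ e.proc = p
    · obtain ⟨e, he, hp⟩ := hev
      cases e with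
      | inv q x =>
        obtain rfl : q = p := hp
        exact ⟨k, x, Nat.lt_succ_self k, he, fun j h1 h2 => by omega⟩
      | res q r =>
        obtain rfl : q = p := hp
        rw [(E.busy_of_res he).2] at h
        cases h
    · push Not at hev
      rw [E.busy_succ_eq hev] at h
      obtain ⟨i, x, hik, hi, hno⟩ := ih h
      refine ⟨i, x, by omega, hi, fun j h1 h2 => ?_⟩
      rcases Nat.lt_succ_iff_lt_or_eq.1 h2 with h3 | rfl
      · exact hno j h1 h3
      · exact hev

theorem obj_reachable (k : ℕ) (i : ι) : (O i).Reachable ((E.config k).obj i) := by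
  induction k generalizing i with
  | zero => rw [E.init]; exact A.initObj_reachable i
  | succ k ih =>
    cases hs : E.sched k with
    | none => rw [(E.stay k hs).2]; exact ih i
    | some p => exact (E.step k p hs).obj_reachable ih i

/-- In a wait-free implementation, a process that takes steps again and again as long as it is
busy becomes idle. -/
theorem exists_idle (hA : A.WaitFree) (m : ℕ) (p : Fin n)
    (h : (∀ k, m ≤ k → (E.config k).busy p = true) → ∀ i, ∃ j, i ≤ j ∧ E.sched j = some p) :
    ∃ k, m ≤ k ∧ (E.config k).busy p = false := by
  by_contra hcon
  push Not at hcon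
  have hbusy : ∀ k, m ≤ k → (E.config k).busy p = true := fun k hk =>
    Bool.eq_true_of_not_eq_false (hcon k hk)
  obtain ⟨i, x, him, hi, hno⟩ := E.exists_pending_of_busy (hbusy m le_rfl)
  obtain ⟨k', r, hc⟩ := hA E p x i hi (h hbusy)
  have hk' : m ≤ k' := by
    by_contra hlt
    exact hno k' hc.2.1 (not_le.1 hlt) _ hc.2.2.1 rfl
  exact hcon (k' + 1) (by omega) (E.busy_of_res hc.2.2.1).2

/-- A finite execution of a wait-free implementation can be continued fairly in such a way that
only process `p` invokes new operations: from some time on all other processes are idle, and `p`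
performs infinitely many operations. -/
theorem exists_solo (hA : A.WaitFree) (m : ℕ) (p : Fin n) (x : T.Inv) :
    ∃ F : A.Execution, Agree E F m ∧
      (∃ N, m ≤ N ∧ ∀ k q, N ≤ k → q ≠ p → (F.config k).busy q = false) ∧
      (∀ k q y, m ≤ k → F.history k = some (.inv q y) → q = p) ∧
      ∀ N, ∃ k k' r, N ≤ k ∧ F.history.Completes k k' p r := by
  classical
  have hn : 0 < n := p.pos
  -- The processes take turns.
  let turn : ℕ → Fin n := fun k => ⟨k % n, Nat.mod_lt k hn⟩
  have hturn : ∀ N q, ∃ k, N ≤ k ∧ turn k = q := fun N q =>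
    ⟨q + n * N, le_add_left (Nat.le_mul_of_pos_left N hn), Fin.ext (by
      simp [turn, Nat.add_mul_mod_self_left, Nat.mod_eq_of_lt q.2])⟩
  have hnext : ∀ (c : Config n O) (k : ℕ), ∃ a : Option (Fin n) × Option (Event n T) × Config n O,
      (a.1 = some (turn k) ∧ A.Step c (turn k) a.2.1 a.2.2 ∧
        (c.busy (turn k) = false → turn k = p ∧ a.2.1 = some (.inv p x))) ∨
      (a.1 = none ∧ a.2.1 = none ∧ a.2.2 = c ∧ c.busy (turn k) = false ∧ turn k ≠ p) := by
    intro c k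
    by_cases hb : c.busy (turn k) = true
    · obtain ⟨e, c', hs⟩ := A.exists_step_of_busy hb
      exact ⟨(some (turn k), e, c'), Or.inl ⟨rfl, hs, fun h => by rw [hb] at h; cases h⟩⟩
    · have hb' := Bool.eq_false_of_not_eq_true hb
      by_cases hp : turn k = p
      · rw [hp] at hb' ⊢
        exact ⟨(some p, some (.inv p x), _), Or.inl ⟨rfl, .invoke c p x hb', fun _ => ⟨rfl, rfl⟩⟩⟩
      · exact ⟨(none, none, c), Or.inr ⟨rfl, rfl, rfl, hb', hp⟩⟩
  choose next hnext using hnext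
  let config : ℕ → Config n O := fun k => Nat.rec (E.config m) (fun k c => (next c k).2.2) k
  have hrun : A.IsRun config (fun k => (next (config k) k).1)
      (fun k => (next (config k) k).2.1) := by
    constructor
    · intro k q hq
      rcases hnext (config k) k with ⟨h1, h2, -⟩ | ⟨h1, -⟩
      · obtain rfl : turn k = q := Option.some_injective _ (h1.symm.trans hq)
        exact h2
      · cases hq.symm.trans h1
    · intro k hq
      rcases hnext (config k) k with ⟨h1, -⟩ | ⟨-, h2, h3, -⟩
      · cases hq.symm.trans h1
      · exact ⟨h2, h3⟩
  obtain ⟨F, hEF, hFc, hFs, hFh⟩ := E.exists_splice m hrun rfl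
  have hinv : ∀ k q y, m ≤ k → F.history k = some (.inv q y) → q = p := by
    intro k q y hk he
    obtain ⟨j, rfl⟩ := Nat.exists_eq_add_of_le hk
    have hbusy := (F.busy_of_inv he).1
    rw [hFh] at he
    rw [hFc] at hbusy
    rcases hnext (config j) j with ⟨-, h2, h3⟩ | ⟨-, h2, -⟩
    · rw [he] at h2
      have hq : q = turn j := h2.proc_eq
      rw [hq] at hbusy ⊢
      exact (h3 hbusy).1
    · cases he.symm.trans h2
  have hsched : ∀ q N, (∀ k, N ≤ k → (F.config k).busy q = true) →
      ∀ i, ∃ j, i ≤ j ∧ F.sched j = some q := by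
    intro q N hb i
    obtain ⟨k, hk, rfl⟩ := hturn (max i N) q
    refine ⟨m + k, by omega, ?_⟩
    rw [hFs]
    rcases hnext (config k) k with ⟨h1, -⟩ | ⟨-, -, -, h4, -⟩
    · exact h1
    · rw [← hFc, hb _ (by omega)] at h4
      cases h4
  have hidle : ∀ q N, ∃ k, N ≤ k ∧ (F.config k).busy q = false := fun q N =>
    F.exists_idle hA N q (hsched q N)
  refine ⟨F, hEF, ?_, hinv, fun N => ?_⟩
  · choose f hf hf' using fun q => hidle q m
    refine ⟨m + Finset.univ.sup f, Nat.le_add_right _ _, fun k q hk hq => ?_⟩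
    have hfk : f q ≤ k := (Finset.le_sup (f := f) (Finset.mem_univ q)).trans (by omega)
    exact F.idle_of_no_inv hfk (hf' q) fun j y h1 _ he => hq (hinv j q y ((hf q).trans h1) he)
  · obtain ⟨i, hi, hidle_i⟩ := hidle p (max N m)
    have hex : ∃ k y, i ≤ k ∧ F.history k = some (.inv p y) := by
      by_contra hcon
      push Not at hcon
      obtain ⟨k, hk, hkp⟩ := hturn i p
      have hb := F.idle_of_no_inv (k := m + k) (by omega) hidle_i fun j y h1 _ => hcon j y h1
      rw [hFc] at hb
      rcases hnext (config k) k with ⟨-, -, h3⟩ | ⟨-, -, -, -, h5⟩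
      · rw [hkp] at h3
        exact hcon (m + k) x (by omega) ((hFh k).trans (h3 hb).2)
      · exact h5 hkp
    obtain ⟨k, y, hk, he⟩ := hex
    obtain ⟨k', hk', hb⟩ := hidle p (k + 1)
    obtain ⟨j, r, -, hc⟩ := F.exists_completes_of_idle he hk' hb
    exact ⟨k, j, r, by omega, hc⟩

end Execution
end Implementation

/-! ### Stable executions -/

namespace History

variable {n : ℕ} {V : Type} [Primcodable V] {H : History n (fetchAndCons V)}

/-- If an operation `k` returns a list whose length is the number of operations invoked before `k`,
and no operation is invoked while `k` is being executed, then every explanation starts with the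
operations up to `k`: those invoked later have to follow `k` by the real-time order, so only the
operations invoked before `k` are left to fill the positions before `k`. -/
theorem Explains.mem_take_iff {t m k k' : ℕ} {p : Fin n} {r : List V} {l : List ℕ}
    (h : H.Explains t m l) (hc : H.Completes k k' p r) (ht : t ≤ k') (hm : k' < m)
    (hr : r.length = ((Finset.range k).filter fun i => (H.value i).isSome = true).card)
    (hno : ∀ i, k < i → i ≤ k' → H.value i = none) (i : ℕ) :
    i ∈ l.take (r.length + 1) ↔ i ≤ k' ∧ (H.value i).isSome = true := by
  have hk := (h.same k k' p r hc ht hm).1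
  obtain ⟨hlen, hget⟩ := List.getElem?_eq_some_iff.1 hk
  have hinj : ∀ {a b : ℕ}, l[a]? = some i → l[b]? = some i → a = b := by
    intro a b ha hb
    obtain ⟨h1, h2⟩ := List.getElem?_eq_some_iff.1 ha
    obtain ⟨h3, h4⟩ := List.getElem?_eq_some_iff.1 hb
    exact (h.nodup.getElem_inj_iff).1 (h2.trans h4.symm)
  have hsub : ∀ i, i ∈ l.take (r.length + 1) → i ≤ k' ∧ (H.value i).isSome = true := by
    intro i hi
    refine ⟨?_, h.invoked i (List.mem_of_mem_take hi)⟩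
    obtain ⟨j, hj, hji⟩ := List.mem_take_iff_getElem.1 hi
    by_contra hcon
    have hjl : j < l.length := by omega
    have := h.order k k' p r i j hc ht hm (by omega) (List.getElem?_eq_some_iff.2 ⟨hjl, hji⟩)
    omega
  refine ⟨hsub i, fun ⟨hi, hv⟩ => ?_⟩
  have hset : (l.take (r.length + 1)).toFinset =
      insert k ((Finset.range k).filter fun i => (H.value i).isSome = true) := by
    refine Finset.eq_of_subset_of_card_le (fun i hi => ?_) ?_
    · obtain ⟨h1, h2⟩ := hsub i (List.mem_toFinset.1 hi)
      rw [Finset.mem_insert, Finset.mem_filter, Finset.mem_range]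
      rcases lt_trichotomy i k with h3 | h3 | h3
      · exact Or.inr ⟨h3, h2⟩
      · exact Or.inl h3
      · rw [hno i h3 h1] at h2
        cases h2
    · rw [List.toFinset_card_of_nodup (h.nodup.sublist (List.take_sublist _ _)),
        List.length_take, Finset.card_insert_of_notMem (by simp), ← hr]
      omega
  rw [← List.mem_toFinset, hset, Finset.mem_insert, Finset.mem_filter, Finset.mem_range]
  rcases lt_trichotomy i k with h3 | h3 | h3
  · exact Or.inr ⟨h3, hv⟩
  · exact Or.inl h3
  · rw [hno i h3 hi] at hv
    cases hv

end History

namespace Implementation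

variable {n : ℕ} {V : Type} [Primcodable V] {ι : Type} [Primcodable ι] {O : ι → DataType.{u}}
  {A : Implementation n O (fetchAndCons V)}

/-- Some finite execution is stable: there is a `t`, independent of the continuation, from which on
all responses in all its finite continuations are explained. Otherwise, every finite execution has
a continuation that cannot be explained from its end on; iterating this gives an infinite execution
that is not `t`-linearizable for any `t`. -/
theorem EventuallyLinearizable.exists_stable (hA : A.EventuallyLinearizable) :
    ∃ (E : A.Execution) (t : ℕ), ∀ F, Execution.Agree E F t → ∀ m, t ≤ m →
      ∃ l, F.history.Explains t m l := by
  by_contra hcon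
  push Not at hcon
  have hstep : ∀ a : A.Execution × ℕ, ∃ b : A.Execution × ℕ, Execution.Agree a.1 b.1 a.2 ∧
      a.2 < b.2 ∧ ∀ l, ¬ b.1.history.Explains a.2 b.2 l := by
    rintro ⟨E, t⟩
    obtain ⟨F, hF, m, htm, hm⟩ := hcon E t
    refine ⟨(F, m), hF, lt_of_le_of_ne htm ?_, hm⟩
    rintro rfl
    exact hm [] (F.history.explains_nil t)
  choose next h1 h2 h3 using hstep
  let E₀ : A.Execution := ⟨fun _ => A.initConfig, fun _ => none, fun _ => none, rfl,
    fun k p hk => by (cases hk), fun k _ => ⟨rfl, rfl⟩⟩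
  let a : ℕ → A.Execution × ℕ := fun i => Nat.rec (E₀, 0) (fun _ b => next b) i
  have hmono : StrictMono fun i => (a i).2 := strictMono_nat_of_lt_succ fun i => h2 (a i)
  obtain ⟨F, hF⟩ := Execution.exists_limit (fun i => (a i).1) (fun i => (a i).2) hmono
    fun i => h1 (a i)
  obtain ⟨-, t, ht⟩ := hA F
  obtain ⟨t₀, ht₀⟩ := ht.exists_explains
  obtain ⟨l, hl⟩ := ht₀ (a t₀).2 (a (t₀ + 1)).2 hmono.le_apply
  exact h3 (a t₀) l (hl.congr fun i hi => ((hF (t₀ + 1)).history i hi).symm)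

/-- There are a stable finite execution (the part of `E` up to time `k' + 1`) at the end of which
all processes are idle, and an operation `k`, the last one of this execution, such that the
response of `k` contains all previous operations. It is found by letting one process run alone
after a stable execution: a linearization of the resulting infinite history contains each of the
operations that have been invoked before the others fall idle, so almost all operations invoked
later come after those. -/
theorem exists_anchor (hW : A.WaitFree) (hA : A.EventuallyLinearizable) (p : Fin n) (v : V) :
    ∃ (E : A.Execution) (t k k' : ℕ) (r : List V), t ≤ k' ∧ E.history.Completes k k' p r ∧
      (∀ q, (E.config (k' + 1)).busy q = false) ∧
      (∀ i, k < i → i ≤ k' → E.history.value i = none) ∧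
      r.length = ((Finset.range k).filter fun i => (E.history.value i).isSome = true).card ∧
      ∀ F, Execution.Agree E F (k' + 1) → ∀ m, k' < m → ∃ l, F.history.Explains t m l := by
  obtain ⟨E₀, t, hstable⟩ := hA.exists_stable
  obtain ⟨E, hE, ⟨N₁, htN, hidle⟩, hsolo, hinf⟩ := E₀.exists_solo hW t p v
  obtain ⟨-, t₁, S, hS⟩ := hA E
  obtain ⟨t₂, ht₂⟩ := E.history.exists_forall_inSuffix t₁
  set H := E.history
  set N := max N₁ t₂
  have hsuff : ∀ {k} {e}, N ≤ k → H k = some e → H.InSuffix t₁ k := fun hk he =>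
    ht₂ _ ((le_max_right _ _).trans hk) (by rw [he]; rfl)
  have hidleAt : ∀ {k k' r q}, N ≤ k → H.Completes k k' p r → (E.config k).busy q = false := by
    intro k k' r q hk hc
    by_cases hq : q = p
    · obtain ⟨⟨x, hx⟩, -⟩ := hc
      rw [hq]
      exact (E.busy_of_inv hx).1
    · exact hidle k q ((le_max_left _ _).trans hk) hq
  -- `B` bounds the slots of the operations that are invoked before `N`.
  obtain ⟨B, hB⟩ : ∃ B, ∀ i, i < N → ∀ j r, S j = some (i, r) → j < B := by
    choose f hf using fun i : ℕ =>
      (show ∃ b, ∀ j r, S j = some (i, r) → j < b by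
        by_cases h : ∃ j r, S j = some (i, r)
        · obtain ⟨j, r, h⟩ := h
          exact ⟨j + 1, fun j' r' h' => by rw [hS.legal.1 j' j i r' r h' h]; omega⟩
        · exact ⟨0, fun j r hj => absurd ⟨j, r, hj⟩ h⟩)
    exact ⟨(Finset.range N).sup f, fun i hi j r hj =>
      (hf i j r hj).trans_le (Finset.le_sup (f := f) (Finset.mem_range.2 hi))⟩
  obtain ⟨k, k', r, j, hk, hc, hj, hBj⟩ : ∃ k k', ∃ r : List V, ∃ j, N ≤ k ∧
      H.Completes k k' p r ∧ S j = some (k, r) ∧ B ≤ j := by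
    by_contra hcon
    push Not at hcon
    have hinf' : {k | N ≤ k ∧ ∃ k' r, H.Completes k k' p r}.Infinite :=
      Set.infinite_of_forall_exists_gt fun a => by
        obtain ⟨k, k', r, hk, hc⟩ := hinf (max N (a + 1))
        exact ⟨k, ⟨by omega, k', r, hc⟩, by omega⟩
    have : ∀ k ∈ {k | N ≤ k ∧ ∃ k' r, H.Completes k k' p r},
        ∃ j, j < B ∧ ∃ r, S j = some (k, r) := by
      rintro k ⟨hk, k', r, hc⟩
      obtain ⟨j, hj⟩ := hS.same k k' p r hc (hsuff (hk.trans hc.2.1.le) hc.2.2.1)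
      exact ⟨j, hcon k k' r j hk hc hj, r, hj⟩
    choose! f hf hf' using this
    refine hinf' (Set.Finite.of_injOn (f := f) (fun k hk => Set.mem_Iio.2 (hf k hk))
      (fun a ha b hb hab => ?_) (Set.finite_Iio B))
    obtain ⟨r, hr⟩ := hf' a ha
    obtain ⟨r', hr'⟩ := hf' b hb
    rw [hab, hr'] at hr
    cases hr
    rfl
  have hkk' := hc.2.1
  have hno : ∀ i, k < i → i ≤ k' → H.value i = none := by
    intro i h1 h2
    rw [Option.eq_none_iff_forall_ne_some]
    intro x hx
    obtain ⟨q, hq⟩ := History.value_eq_some.1 hx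
    obtain rfl := hsolo i q x (by omega) hq
    rcases h2.lt_or_eq with h2 | rfl
    · exact hc.2.2.2 i h1 h2 _ hq rfl
    · cases hq.symm.trans hc.2.2.1
  have hlen : r.length = ((Finset.range k).filter fun i => (H.value i).isSome = true).card := by
    rw [← hS.legal.length_slots hj, ← List.toFinset_card_of_nodup (hS.legal.nodup_slots j)]
    congr 1
    ext i
    rw [List.mem_toFinset, Finset.mem_filter, Finset.mem_range]
    constructor
    · intro hi
      refine ⟨?_, hS.legal.isSome_value_of_mem hi⟩
      obtain ⟨q, x, hx⟩ := History.isSome_value.1 (hS.legal.isSome_value_of_mem hi)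
      obtain ⟨j', r', hj', hS'⟩ := History.mem_slots.1 hi
      by_contra hki
      rcases lt_or_ge k' i with h1 | h1
      · obtain ⟨j₁, r₁, h2, h3⟩ := hS.order k k' p r i j' r' hc h1
          (hsuff (by omega) hc.2.2.1) (hsuff (by omega) hx) hS'
        have := hS.legal.1 j j₁ k r r₁ hj h3
        omega
      · rcases (not_lt.1 hki).lt_or_eq with h2 | rfl
        · have := hS.legal.isSome_value_of_mem hi
          rw [hno i h2 h1] at this
          cases this
        · have := hS.legal.1 j j' k r r' hj hS'
          omega
    · rintro ⟨hi, hv⟩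
      obtain ⟨q, x, hx⟩ := History.isSome_value.1 hv
      obtain ⟨i', r', hi', hci⟩ := E.exists_completes_of_idle hx hi (hidleAt hk hc)
      obtain ⟨y, hy⟩ := hc.1
      rcases lt_or_ge i N with h1 | h1
      · obtain ⟨j₁, r₁, h2⟩ := hS.complete i i' q r' hci
        exact History.mem_slots.2 ⟨j₁, r₁, (hB i h1 j₁ r₁ h2).trans_le hBj, h2⟩
      · obtain ⟨j₁, r₁, h2, h3⟩ := hS.order i i' q r' k j r hci hi'
          (hsuff (h1.trans hci.2.1.le) hci.2.2.1) (hsuff hk hy) hj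
        exact History.mem_slots.2 ⟨j₁, r₁, h2, h3⟩
  refine ⟨E, t, k, k', r, by omega, hc, fun q => ?_, hno, hlen, fun F hF m hm =>
    hstable F (hE.trans (hF.mono (by omega))) m (by omega)⟩
  by_cases hq : q = p
  · rw [hq]
    exact (E.busy_of_res hc.2.2.1).2
  · exact hidle _ q (by omega) hq

end Implementation

/-! ### Restarting an implementation in the middle of an execution -/

section MapRet

variable {n : ℕ} {ι : Type} {O : ι → DataType.{u}} {T : DataType.{v}}

/-- Apply `f` to the value of a return action. -/
def ProgramAction.mapRet (f : T.Res → T.Res) : ProgramAction O T → ProgramAction O T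
  | .compute m => .compute m
  | .access i x => .access i x
  | .ret r m => .ret (f r) m

/-- Apply `f` to the value of a response event. -/
def Event.mapRes (f : T.Res → T.Res) : Event n T → Event n T
  | .inv p x => .inv p x
  | .res p r => .res p (f r)

@[simp] theorem Event.proc_mapRes (f : T.Res → T.Res) (e : Event n T) :
    (e.mapRes f).proc = e.proc := by
  cases e <;> rfl

/-- The program that works as `P` does, but applies `f` to each value before returning it. -/
def Program.mapRet [Primcodable ι] (P : Program O T) (f : T.Res → T.Res) (hf : Computable f) :
    Program O T where
  start := P.start
  next := fun m => (P.next m).mapRet f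
  receive := P.receive
  start_computable := P.start_computable
  receive_computable := P.receive_computable
  next_computable := by
    let g : ℕ × ℕ → ℕ × ℕ := fun a =>
      ((((Encodable.decode a.1 : Option T.Res).map f).map Encodable.encode).getD 0, a.2)
    have hg : Computable g := by
      refine Computable.pair (Computable.option_getD (Computable.option_map (Computable.option_map
        (Computable.decode.comp Computable.fst) (hf.comp Computable.snd).to₂)
        (Computable.encode.comp Computable.snd).to₂) (Computable.const 0)) Computable.snd
    have hd : Computable fun d : (ℕ × ℕ) ⊕ (ℕ × ℕ) =>
        (Sum.casesOn d (fun a => Sum.inr (Sum.inl a)) fun a => Sum.inr (Sum.inr (g a)) :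
          ℕ ⊕ (ℕ × ℕ) ⊕ (ℕ × ℕ)) :=
      Computable.sumCasesOn Computable.id
        (Computable.sumInr.comp (Computable.sumInl.comp Computable.snd)).to₂
        (Computable.sumInr.comp (Computable.sumInr.comp (hg.comp Computable.snd))).to₂
    have hc : Computable fun c : ℕ ⊕ (ℕ × ℕ) ⊕ (ℕ × ℕ) =>
        (Sum.casesOn c Sum.inl fun d => Sum.casesOn d (fun a => Sum.inr (Sum.inl a))
          fun a => Sum.inr (Sum.inr (g a)) : ℕ ⊕ (ℕ × ℕ) ⊕ (ℕ × ℕ)) :=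
      Computable.sumCasesOn Computable.id (Computable.sumInl.comp Computable.snd).to₂
        (hd.comp Computable.snd).to₂
    refine (hc.comp P.next_computable).of_eq fun m => ?_
    cases P.next m <;> simp [ProgramAction.code, ProgramAction.mapRet, g]

variable [Primcodable ι]

/-- The implementation that starts with the local memories and the objects as they are in the
execution `E` of `A` at time `m`, continues as `A` does, and applies `f` to the responses. -/
def Implementation.restart (A : Implementation n O T) (E : A.Execution) (m : ℕ)
    (f : T.Res → T.Res) (hf : Computable f) : Implementation n O T where
  prog := fun p => (A.prog p).mapRet f hf
  initMem := (E.config m).mem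
  initObj := (E.config m).obj
  initObj_reachable := E.obj_reachable m

namespace Implementation

variable {A : Implementation n O T} {E : A.Execution} {m : ℕ} {f : T.Res → T.Res}
  {hf : Computable f}

theorem Step.of_restart {c c' : Config n O} {p : Fin n} {e : Option (Event n T)}
    (h : (A.restart E m f hf).Step c p e c') :
    ∃ e', A.Step c p e' c' ∧ e = e'.map (Event.mapRes f) := by
  cases h with
  | invoke x hidle => exact ⟨_, .invoke c p x hidle, rfl⟩
  | compute a hb hn =>
    refine ⟨_, .compute c p a hb ?_, rfl⟩
    change ((A.prog p).next (c.mem p)).mapRet f = _ at hn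
    cases h : (A.prog p).next (c.mem p) <;> simp_all [ProgramAction.mapRet]
  | access i x r s hb hn ht =>
    refine ⟨_, .access c p i x r s hb ?_ ht, rfl⟩
    change ((A.prog p).next (c.mem p)).mapRet f = _ at hn
    cases h : (A.prog p).next (c.mem p) <;> simp_all [ProgramAction.mapRet]
  | ret r a hb hn =>
    change ((A.prog p).next (c.mem p)).mapRet f = _ at hn
    cases h : (A.prog p).next (c.mem p) with
    | compute a' => rw [h] at hn; cases hn
    | access i x => rw [h] at hn; cases hn
    | ret r' a' =>
      rw [h] at hn
      cases hn
      exact ⟨_, .ret c p r' a hb h, rfl⟩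

/-- An execution of the restarted implementation is, up to the change of the responses, the second
part of an execution of `A` that starts as `E` does. -/
theorem Execution.exists_of_restart (hidle : ∀ p, (E.config m).busy p = false)
    (F : (A.restart E m f hf).Execution) :
    ∃ G : A.Execution, Execution.Agree E G m ∧ (∀ k, G.sched (m + k) = F.sched k) ∧
      ∀ k, F.history k = (G.history (m + k)).map (Event.mapRes f) := by
  have hex : ∀ k, ∃ e : Option (Event n T),
      (∀ p, F.sched k = some p → A.Step (F.config k) p e (F.config (k + 1))) ∧
      (F.sched k = none → e = none) ∧ F.history k = e.map (Event.mapRes f) := by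
    intro k
    cases hs : F.sched k with
    | none => exact ⟨none, by simp, fun _ => rfl, (F.stay k hs).1⟩
    | some p =>
      obtain ⟨e, h1, h2⟩ := (F.step k p hs).of_restart
      refine ⟨e, fun q hq => ?_, by simp, h2⟩
      cases hq
      exact h1
  choose e h1 h2 h3 using hex
  have hrun : A.IsRun F.config F.sched e :=
    ⟨h1, fun k hk => ⟨h2 k hk, (F.stay k hk).2⟩⟩
  obtain ⟨G, hG, -, hs, hh⟩ := E.exists_splice m hrun (by
    rw [F.init]
    ext p
    · rfl
    · simp [initConfig, hidle]
    · rfl)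
  exact ⟨G, hG, hs, fun k => by rw [hh, h3]⟩

end Implementation

/-- The completed operations of `H` are those invoked in `G` from time `m` on, with their responses
changed by `f`. -/
theorem History.completes_shift_iff {H G : History n T} {m : ℕ} {f : T.Res → T.Res}
    (h : ∀ k, H k = (G (m + k)).map (Event.mapRes f)) {k k' : ℕ} {p : Fin n} {r : T.Res} :
    H.Completes k k' p r ↔ ∃ r', G.Completes (m + k) (m + k') p r' ∧ f r' = r := by
  have hinv : ∀ {k p x}, H k = some (.inv p x) ↔ G (m + k) = some (.inv p x) := by
    intro k p x
    rw [h]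
    rcases G (m + k) with _ | (⟨q, y⟩ | ⟨q, r⟩) <;> simp [Event.mapRes]
  have hres : ∀ {k p r}, H k = some (.res p r) ↔ ∃ r', G (m + k) = some (.res p r') ∧ f r' = r := by
    intro k p r
    rw [h]
    rcases G (m + k) with _ | (⟨q, y⟩ | ⟨q, r⟩) <;> simp [Event.mapRes]
  constructor
  · rintro ⟨⟨x, hx⟩, hlt, hr, hno⟩
    obtain ⟨r', hr', hfr⟩ := hres.1 hr
    refine ⟨r', ⟨⟨x, hinv.1 hx⟩, by omega, hr', fun j h1 h2 e he => ?_⟩, hfr⟩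
    obtain ⟨i, rfl⟩ := Nat.exists_eq_add_of_le (show m ≤ j by omega)
    rw [← Event.proc_mapRes f e]
    exact hno i (by omega) (by omega) _ (by rw [h, he]; rfl)
  · rintro ⟨r', ⟨⟨x, hx⟩, hlt, hr, hno⟩, hfr⟩
    refine ⟨⟨x, hinv.2 hx⟩, by omega, hres.2 ⟨r', hr, hfr⟩, fun j h1 h2 e he => ?_⟩
    rw [h] at he
    obtain ⟨e', he', rfl⟩ := Option.map_eq_some_iff.1 he
    rw [Event.proc_mapRes]
    exact hno (m + j) (by omega) (by omega) e' he'

end MapRet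

namespace Implementation

variable {n : ℕ} {ι : Type} [Primcodable ι] {O : ι → DataType.{u}} {T : DataType.{v}}

theorem WaitFree.restart {A : Implementation n O T} (hA : A.WaitFree) {E : A.Execution} {m : ℕ}
    (hidle : ∀ p, (E.config m).busy p = false) {f : T.Res → T.Res} (hf : Computable f) :
    (A.restart E m f hf).WaitFree := by
  intro F p x k hk hinf
  obtain ⟨G, -, hs, hh⟩ := Implementation.Execution.exists_of_restart hidle F
  have hk' : G.history (m + k) = some (.inv p x) := by
    rw [hh] at hk
    rcases h : G.history (m + k) with _ | (⟨q, y⟩ | ⟨q, r⟩) <;> simp_all [Event.mapRes]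
  obtain ⟨k', r, hc⟩ := hA G p x (m + k) hk' fun i => by
    obtain ⟨j, hij, hj⟩ := hinf i
    exact ⟨m + j, by omega, by rw [hs, hj]⟩
  obtain ⟨j, rfl⟩ := Nat.exists_eq_add_of_le (show m ≤ k' by have := hc.2.1; omega)
  exact ⟨j, f r, (History.completes_shift_iff hh).2 ⟨r, hc, rfl⟩⟩

end Implementation

/-- If the explanation `l` of `G` starts with the `c` operations invoked before `m`, then the rest
of `l` explains the history after time `m` in which the last `c` entries, which are the values of
these operations, have been removed from each response. -/
theorem History.Explains.shift {n : ℕ} {V : Type} [Primcodable V]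
    {G H : History n (fetchAndCons V)} {t m m' c : ℕ} {l : List ℕ} (h : G.Explains t (m + m') l)
    (htm : t ≤ m) (hc : c ≤ l.length)
    (hl : ∀ i, i ∈ l.take c ↔ i < m ∧ (G.value i).isSome = true)
    (hH : ∀ k, H k = (G (m + k)).map (Event.mapRes fun r : List V => r.rdrop c)) :
    H.Explains 0 m' ((l.drop c).map (· - m)) := by
  have hval : ∀ k, H.value k = G.value (m + k) := by
    intro k
    unfold History.value
    rw [hH]
    rcases G (m + k) with _ | (⟨q, y⟩ | ⟨q, r⟩) <;> simp [Event.mapRes]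
  have hdisj : (l.take c).Disjoint (l.drop c) := List.disjoint_take_drop h.nodup le_rfl
  have hge : ∀ k ∈ l.drop c, m ≤ k := by
    intro k hk
    by_contra hcon
    exact hdisj ((hl k).2 ⟨not_le.1 hcon, h.invoked k (List.mem_of_mem_drop hk)⟩) hk
  have hget : ∀ {j k}, ((l.drop c).map (· - m))[j]? = some k ↔ l[c + j]? = some (m + k) := by
    intro j k
    rw [List.getElem?_map, List.getElem?_drop, Option.map_eq_some_iff]
    constructor
    · rintro ⟨i, hi, rfl⟩
      rw [hi, Nat.add_sub_cancel' (hge i (List.mem_of_getElem? (i := j)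
        (by rw [List.getElem?_drop, hi])))]
    · intro hk
      exact ⟨m + k, hk, by simp⟩
  -- The operations of `H` come after the first `c` operations, so no response is shorter than `c`.
  have hlen : ∀ {k k' p} {r : List V}, G.Completes (m + k) k' p r → t ≤ k' → k' < m + m' →
      c ≤ r.length := by
    intro k k' p r hr ht hm
    by_contra hcon
    have h1 := (h.same _ _ p r hr ht hm).1
    have h2 : m + k ∈ l.take c := by
      refine List.mem_of_getElem? (i := r.length) ?_
      rw [List.getElem?_take_of_lt (not_le.1 hcon), h1]
    have := ((hl _).1 h2).1
    omega
  refine ⟨?_, fun k hk => ?_, fun k hk => ?_, fun k k' p r hr _ hm => ?_,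
    fun k₁ k₁' p r k₂ j hr _ hm hlt hj => ?_⟩
  · refine List.Nodup.map_on (fun a ha b hb hab => ?_) (h.nodup.sublist (List.drop_sublist _ _))
    have := hge a ha
    have := hge b hb
    omega
  · obtain ⟨i, hi, rfl⟩ := List.mem_map.1 hk
    have := hge i hi
    have := h.lt i (List.mem_of_mem_drop hi)
    omega
  · obtain ⟨i, hi, rfl⟩ := List.mem_map.1 hk
    rw [hval, Nat.add_sub_cancel' (hge i hi)]
    exact h.invoked i (List.mem_of_mem_drop hi)
  · obtain ⟨r', hr', rfl⟩ := (History.completes_shift_iff hH).1 hr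
    obtain ⟨h1, h2⟩ := h.same _ _ p r' hr' (by omega) (by omega)
    have hcr := hlen hr' (by omega) (by omega)
    have hlr : (List.rdrop r' c).length = r'.length - c := by simp [List.rdrop]
    have hcont : H.contents (((l.drop c).map (· - m)).take (r'.length - c)) =
        G.contents ((l.drop c).take (r'.length - c)) := by
      unfold History.contents
      rw [← List.map_take, ← List.map_reverse, List.filterMap_map]
      refine List.filterMap_congr fun i hi => ?_
      rw [Function.comp_apply, hval,
        Nat.add_sub_cancel' (hge i (List.mem_of_mem_take (List.mem_reverse.1 hi)))]
    refine ⟨?_, ?_⟩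
    · rw [hget, hlr, Nat.add_sub_cancel' hcr, h1]
    · rw [hlr, hcont]
      have hsplit : l.take r'.length = l.take c ++ (l.drop c).take (r'.length - c) := by
        rw [← List.take_add, Nat.add_sub_cancel' hcr]
      rw [hsplit, History.contents_append] at h2
      have h3 : (G.contents (l.take c)).length = c := by
        rw [History.length_contents fun k hk => ((hl k).1 hk).2, List.length_take]
        omega
      conv_rhs => rw [← h2]
      simp [List.rdrop, h3]
  · obtain ⟨r', hr', rfl⟩ := (History.completes_shift_iff hH).1 hr
    have h1 := h.order _ _ p r' (m + k₂) (c + j) hr' (by omega) (by omega) (by omega) (hget.1 hj)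
    have hcr := hlen hr' (by omega) (by omega)
    have hlr : (List.rdrop r' c).length = r'.length - c := by simp [List.rdrop]
    rw [hlr]
    omega

theorem proposition10 (n : ℕ) (V : Type) [Primcodable V] {ι : Type} [Primcodable ι]
    (O : ι → DataType.{u})
    (h : ∃ A : Implementation n O (fetchAndCons V), A.WaitFree ∧ A.EventuallyLinearizable) :
    ∃ A : Implementation n O (fetchAndCons V), A.WaitFree ∧ A.Linearizable := by
  obtain ⟨A, hW, hA⟩ := h
  by_cases hne : Nonempty (Fin n) ∧ Nonempty V
  swap
  · -- Without processes or without values nothing can be invoked.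
    refine ⟨A, hW, fun E => History.linearizable_of_forall_explains fun m => ⟨[], by simp, by simp,
      by simp, fun k k' p r hc _ _ => ?_, by simp⟩⟩
    obtain ⟨x, -⟩ := hc.1
    exact absurd ⟨⟨p⟩, ⟨x⟩⟩ hne
  obtain ⟨⟨p⟩, ⟨v⟩⟩ := hne
  obtain ⟨E, t, k, k', r, ht, hc, hidle, hno, hlen, hE⟩ := Implementation.exists_anchor hW hA p v
  have hf : Computable fun s : List V => s.rdrop (r.length + 1) := by
    refine Primrec.to_comp ?_
    exact Primrec.list_take.comp
      (Primrec.nat_sub.comp Primrec.list_length (Primrec.const _)) Primrec.id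
  refine ⟨A.restart E (k' + 1) _ hf, hW.restart hidle hf, fun F =>
    History.linearizable_of_forall_explains fun m => ?_⟩
  obtain ⟨G, hG, -, hh⟩ := Implementation.Execution.exists_of_restart hidle F
  obtain ⟨l, hl⟩ := hE G hG (k' + 1 + m) (by omega)
  have hvG : ∀ i, i ≤ k' → E.history.value i = G.history.value i := fun i hi => by
    unfold History.value
    rw [hG.history i (by omega)]
  have hcG := hc.congr (Nat.lt_succ_self k') hG.history
  have hmem := hl.mem_take_iff hcG ht (by omega) (by
    rw [hlen]
    congr 1
    refine Finset.filter_congr fun i hi => ?_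
    rw [hvG i ((Finset.mem_range.1 hi).le.trans hc.2.1.le)]) fun i h1 h2 => by
      rw [← hvG i h2, hno i h1 h2]
  obtain ⟨hlt, -⟩ := List.getElem?_eq_some_iff.1 (hl.same _ _ p r hcG ht (by omega)).1
  exact ⟨_, hl.shift (c := r.length + 1) (by omega) hlt
    (fun i => by rw [hmem, Nat.lt_succ_iff]) hh⟩
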